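/- A signed graph $\Sigma=(G,\sigma)$ is a finite simple graph $G$ with a sign function $\sigma:E(G)\to\{1,-1\}$. A cycle is unbalanced if it has an odd number of negative edges, and a connected component of $\Sigma$ is unbalanced if it contains an unbalanced cycle. A map $c:V(\Sigma)\to\mathbb{Z}$ is a proper coloring if $c(u)\neq\sigma(e)c(v)$ for each edge $e=uv$. For a positive integer $k$, let $M_k=\{\pm1,\ldots,\pm t\}$ if $k=2t$ and $M_k=\{0,\pm1,\ldots,\pm t\}$ if $k=2t+1$, and let $P(\Sigma,k)$ be the number of proper colorings $c:V(\Sigma)\to M_k$; write it as $P^0(\Sigma,k)$ if $k$ is even and as $P^1(\Sigma,k)$ if $k$ is odd. A $k$-assignment $L$ gives every vertex $v$ a set $L(v)\subset\mathbb{Z}$ with $|L(v)|=k$; it is $0$-free if $0\notin L(v)$ for every $v$, and $0$-included if $0\in L(v)$ for every $v$. Let $P(\Sigma,L)$ be the number of proper colorings $c$ with $c(v)\in L(v)$ for every vertex $v$, and put $$P_l^0(\Sigma,k)=\min\{P(\Sigma,L): L\text{ is a }0\text{-free }k\text{-assignment}\},\qquad P_l^1(\Sigma,k)=\min\{P(\Sigma,L):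 L\text{ is a }0\text{-included }k\text{-assignment}\}.$$ **Theorem.** Let $\Sigma$ be a signed graph with $m$ edges and let $k$ be a positive integer with $$k>\frac{m-1}{\ln(1+\sqrt2)}.$$ If $k$ is even, then $P_l^0(\Sigma,k)=P^0(\Sigma,k)$; if $k$ is odd, then $P_l^1(\Sigma,k)=P^1(\Sigma,k)$. Further, every $0$-free (for $k$ even), respectively $0$-included (for $k$ odd), $k$-assignment $L$ that attains this minimum satisfies $L(v)=\sigma(e)L(u)=\{\sigma(e)a:a\in L(u)\}$ for each edge $e=uv$ of $\Sigma$, and $L(v)=-L(v)=\{-a:a\in L(v)\}$ for each vertex $v$ in any unbalanced component of $\Sigma$. -/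

import Mathlib

/-- A signed graph: a simple underlying graph together with a sign in `{1, -1}` for every edge. -/
structure SignedGraph (V : Type*) where
  /-- the underlying graph -/
  graph : SimpleGraph V
  /-- the sign function, defined on the edges -/
  sign : graph.edgeSet → ℤˣ

namespace SignedGraph

variable {V : Type*}

/-- The sign of the edge joining two adjacent vertices, as an integer. -/
def adjSign (S : SignedGraph V) {u v : V} (h : S.graph.Adj u v) : ℤ :=
  (S.sign ⟨s(u, v), h⟩ : ℤ)

/-- The number of edges. -/
noncomputable def numEdges (S : SignedGraph V) : ℕ := S.graph.edgeSet.ncard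

/-- The edge `e` is present and negative. -/
def IsNegEdge (S : SignedGraph V) (e : Sym2 V) : Prop :=
  ∃ h : e ∈ S.graph.edgeSet, S.sign ⟨e, h⟩ = -1

open Classical in
/-- The number of negative edges that a walk traverses, counted along the walk. -/
noncomputable def numNeg (S : SignedGraph V) {u v : V} (w : S.graph.Walk u v) : ℕ :=
  w.edges.countP (fun e => decide (S.IsNegEdge e))

/-- A cycle with an odd number of negative edges (the edges of a cycle are distinct). -/
def IsUnbalancedCycle (S : SignedGraph V) {u : V} (w : S.graph.Walk u u) : Prop :=
  w.IsCycle ∧ Odd (S.numNeg w)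

/-- A connected component is unbalanced if it contains an unbalanced cycle. -/
def IsUnbalancedComponent (S : SignedGraph V) (C : S.graph.ConnectedComponent) : Prop :=
  ∃ u ∈ C.supp, ∃ w : S.graph.Walk u u, S.IsUnbalancedCycle w

/-- Properness of a colouring by integers: `c u ≠ σ(e) c v` for each edge `e = uv`. -/
def IsProper (S : SignedGraph V) (c : V → ℤ) : Prop :=
  ∀ (u v : V) (h : S.graph.Adj u v), c u ≠ S.adjSign h * c v

/-- The number of `L`-colourings: proper colourings `c` with `c v ∈ L v` for every vertex `v`. -/
noncomputable def numListColorings (S : SignedGraph V) (L : V → Finset ℤ) : ℕ :=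
  {c : V → ℤ | S.IsProper c ∧ ∀ v, c v ∈ L v}.ncard

/-- The set of `k` colours `{±1, …, ±t}` if `k = 2t`, and `{0, ±1, …, ±t}` if `k = 2t + 1`. -/
noncomputable def colorSet (k : ℕ) : Finset ℤ :=
  if Even k then (Finset.Icc (-((k / 2 : ℕ) : ℤ)) ((k / 2 : ℕ) : ℤ)).erase 0
  else Finset.Icc (-((k / 2 : ℕ) : ℤ)) ((k / 2 : ℕ) : ℤ)

/-- The number of proper `k`-colourings, i.e. proper maps from the vertices to `colorSet k`. -/
noncomputable def numColorings (S : SignedGraph V) (k : ℕ) : ℕ :=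
  {c : V → ℤ | S.IsProper c ∧ ∀ v, c v ∈ colorSet k}.ncard

/-- A `k`-assignment: a list of exactly `k` integer colours at every vertex. -/
def IsAssignment (k : ℕ) (L : V → Finset ℤ) : Prop := ∀ v, (L v).card = k

/-- No list contains the colour `0`. -/
def ZeroFree (L : V → Finset ℤ) : Prop := ∀ v, (0 : ℤ) ∉ L v

/-- Every list contains the colour `0`. -/
def ZeroIncluded (L : V → Finset ℤ) : Prop := ∀ v, (0 : ℤ) ∈ L v

/-- `L v = σ(e) L u` for each edge `e = uv`. -/
def ListsAgree (S : SignedGraph V) (L : V → Finset ℤ) : Prop :=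
  ∀ (u v : V) (h : S.graph.Adj u v), L v = (L u).image (fun a => S.adjSign h * a)

/-- `L v = -L v` for each vertex `v` in an unbalanced component. -/
def ListsSymmetric (S : SignedGraph V) (L : V → Finset ℤ) : Prop :=
  ∀ C : S.graph.ConnectedComponent, S.IsUnbalancedComponent C →
    ∀ v ∈ C.supp, L v = (L v).image (fun a => -a)

end SignedGraph

/-! Each edge is read as the linear constraint that a proper coloring violates. Whitney's broken
circuit theorem writes the number of proper colorings from any lists as the sum of `(-1)^|A|` times
the number of list choices satisfying all of `A`, over sets `A` without broken circuits
(`card_proper_eq_sum`). Such an `A` is independent, so its solutions have `n - |A|` free vertices,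
`n = |V|`.

Let `M` be the standard color set and let the defect of an edge count the colors at one end with no
partner in the list at the other. For every such `A`, `L` admits at most as many solutions as `M`,
with a deficit of at most `k^(n-|A|-1)` times the total defect of `A` (`solCount_compare`). For a
single edge the deficit is at least `k^(n-2)` times its defect (`solCount_singleton_compare`).

Odd sets therefore help `L`, even sets hurt it. Keeping only the gain from singletons and the worst
loss from even sets, `P(L) - P(M)` is at least `k^(n-2)` times the total defect times `1 - ∑_{j odd}
C(m-1,j) k^(-j)`. The last sum is at most `sinh ((m-1)/k)`, which is below `1` by the hypothesis on
`k`. So `M` is optimal, and equality forces every defect to vanish. -/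

/-! ### The analytic estimate behind the threshold. -/

/-- The odd and even parts of `(1 + y)^M` obey the addition formulas of `sinh` and `cosh` with `sinh
y`, `cosh y` replaced by the smaller `y`, `1`; hence the joint induction. -/
theorem odd_part_one_add_pow_le_sinh (M : ℕ) {y : ℝ} (hy : 0 ≤ y) :
    ((1 + y) ^ M - (1 - y) ^ M) / 2 ≤ Real.sinh (M * y) := by
  suffices h : ((1 + y) ^ M - (1 - y) ^ M) / 2 ≤ Real.sinh (M * y) ∧
      ((1 + y) ^ M + (1 - y) ^ M) / 2 ≤ Real.cosh (M * y) from h.1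
  induction M with
  | zero => simp
  | succ M ih =>
    have hs : 0 ≤ Real.sinh (M * y) := Real.sinh_nonneg_iff.2 (by positivity)
    have hc : 0 ≤ Real.cosh (M * y) := (Real.cosh_pos _).le
    have h1 : y ≤ Real.sinh y := Real.self_le_sinh_iff.2 hy
    have h2 := Real.one_le_cosh y
    have e : ((M + 1 : ℕ) : ℝ) * y = M * y + y := by push_cast; ring
    rw [e, Real.sinh_add, Real.cosh_add, pow_succ, pow_succ]
    have a1 := mul_le_mul_of_nonneg_left h2 hs
    have a2 := mul_le_mul_of_nonneg_left h1 hc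
    have a3 := mul_le_mul_of_nonneg_left h2 hc
    have a4 := mul_le_mul_of_nonneg_left h1 hs
    have a5 := mul_le_mul_of_nonneg_left ih.1 hy
    have a6 := mul_le_mul_of_nonneg_left ih.2 hy
    constructor <;> linarith [ih.1, ih.2]

theorem sinh_lt_one_of_lt_log {x : ℝ} (hx : x < Real.log (1 + Real.sqrt 2)) : Real.sinh x < 1 := by
  rw [← Real.sinh_arsinh 1, Real.sinh_lt_sinh, Real.arsinh]
  norm_num
  exact hx

/-! ### Sign constraints and Whitney's broken circuit theorem. -/

/-- A finite family of sign constraints `c (src i) = sgn i * c (tgt i)` on integer vectors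
indexed by `V`. -/
structure SignedEdges (V ι : Type*) where
  /-- first endpoint -/
  src : ι → V
  /-- second endpoint -/
  tgt : ι → V
  /-- sign -/
  sgn : ι → ℤˣ

namespace SignedEdges

variable {V ι : Type*}

/-- The vector `c` satisfies the `i`-th constraint, i.e. it is *not* properly coloured at `i`. -/
def Sat (E : SignedEdges V ι) (c : V → ℤ) (i : ι) : Prop :=
  c (E.src i) = (E.sgn i : ℤ) * c (E.tgt i)

instance (E : SignedEdges V ι) (c : V → ℤ) (i : ι) : Decidable (E.Sat c i) :=
  inferInstanceAs (Decidable (_ = _))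

/-- The `i`-th constraint follows from the constraints in `B`. -/
def Implies (E : SignedEdges V ι) (B : Finset ι) (i : ι) : Prop :=
  ∀ c : V → ℤ, (∀ j ∈ B, E.Sat c j) → E.Sat c i

theorem Implies.mono {E : SignedEdges V ι} {B B' : Finset ι} {i : ι} (h : E.Implies B i)
    (hB : B ⊆ B') : E.Implies B' i :=
  fun c hc => h c fun j hj => hc j (hB hj)

section Whitney

variable [LinearOrder ι]

/-- `A` contains no broken circuit: no constraint follows from the larger constraints in `A`. -/
def NoBrokenCircuit (E : SignedEdges V ι) (A : Finset ι) : Prop :=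
  ∀ i, ¬ E.Implies (A.filter (i < ·)) i

theorem NoBrokenCircuit.mono {E : SignedEdges V ι} {A B : Finset ι} (h : E.NoBrokenCircuit B)
    (hA : A ⊆ B) : E.NoBrokenCircuit A :=
  fun i hi => h i (hi.mono (Finset.filter_subset_filter _ hA))

/-- A constraint below `e` implied by the enlarged set would hold for `c`, against the minimality of
`e`; for any other constraint, `e` is not among the larger ones. -/
theorem NoBrokenCircuit.insert_min {E : SignedEdges V ι} {A : Finset ι} (h : E.NoBrokenCircuit A)
    {c : V → ℤ} (hA : ∀ j ∈ A, E.Sat c j) {e : ι} (he : E.Sat c e)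
    (hmin : ∀ i, E.Sat c i → e ≤ i) : E.NoBrokenCircuit (insert e A) := by
  intro i hi
  by_cases hie : i < e
  · have : E.Sat c i := hi c fun j hj => by
      rcases Finset.mem_insert.1 (Finset.mem_filter.1 hj).1 with rfl | hj
      · exact he
      · exact hA j hj
    exact absurd (hmin i this) (not_le.2 hie)
  · refine h i ?_
    rwa [Finset.filter_insert, if_neg hie] at hi

variable [Fintype ι]

open Classical in
/-- The collection of all sets without broken circuits. -/
noncomputable def nbcSets (E : SignedEdges V ι) : Finset (Finset ι) :=
  Finset.univ.filter E.NoBrokenCircuit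

theorem mem_nbcSets {E : SignedEdges V ι} {A : Finset ι} :
    A ∈ E.nbcSets ↔ E.NoBrokenCircuit A := by
  simp [nbcSets]

/-- Pointwise form of Whitney's broken circuit theorem. -/
theorem sum_nbcSets_neg_one_pow (E : SignedEdges V ι) (hE : ∀ i, ¬ E.Implies ∅ i) (c : V → ℤ) :
    ∑ A ∈ E.nbcSets with ∀ i ∈ A, E.Sat c i, (-1 : ℤ) ^ A.card
      = if ∀ i, ¬ E.Sat c i then 1 else 0 := by
  split_ifs with h
  · have : E.nbcSets.filter (fun A => ∀ i ∈ A, E.Sat c i) = {∅} := by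
      ext A
      simp only [Finset.mem_filter, mem_nbcSets, Finset.mem_singleton]
      constructor
      · rintro ⟨-, hA⟩
        exact Finset.eq_empty_of_forall_notMem fun i hi => h i (hA i hi)
      · rintro rfl
        exact ⟨fun i => by simpa using hE i, by simp⟩
    simp [this]
  · push Not at h
    obtain ⟨e, he, hmin⟩ : ∃ e, E.Sat c e ∧ ∀ i, E.Sat c i → e ≤ i := by
      obtain ⟨i, hi⟩ := h
      have hne : (Finset.univ.filter (E.Sat c)).Nonempty := ⟨i, by simpa using hi⟩
      exact ⟨_, (Finset.mem_filter.1 (Finset.min'_mem _ hne)).2,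
        fun j hj => Finset.min'_le _ _ (by simpa using hj)⟩
    -- Toggling the smallest satisfied constraint `e` reverses the sign and stays within the family.
    refine Finset.sum_involution (fun A _ => if e ∈ A then A.erase e else insert e A) ?_ ?_ ?_ ?_
    · intro A _
      split_ifs with heA
      · rw [← Finset.card_erase_add_one heA, pow_succ]; ring
      · rw [Finset.card_insert_of_notMem heA, pow_succ]; ring
    · intro A _ _ hA
      split_ifs at hA with heA
      · exact (Finset.erase_eq_self.1 hA) heA
      · exact heA (Finset.insert_eq_self.1 hA)
    · intro A hA
      simp only [Finset.mem_filter, mem_nbcSets] at hA ⊢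
      split_ifs with heA
      · exact ⟨hA.1.mono (Finset.erase_subset _ _), fun i hi => hA.2 i (Finset.mem_of_mem_erase hi)⟩
      · refine ⟨hA.1.insert_min hA.2 he hmin, fun i hi => ?_⟩
        rcases Finset.mem_insert.1 hi with rfl | hi
        · exact he
        · exact hA.2 i hi
    · intro A _
      split_ifs with h1 h2 h3
      · simp at h2
      · exact Finset.insert_erase h1
      · exact Finset.erase_insert h1
      · simp at h3

/-- Whitney's broken circuit theorem for colourings from an arbitrary finite set. -/
theorem card_proper_eq_sum (E : SignedEdges V ι) (hE : ∀ i, ¬ E.Implies ∅ i)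
    (X : Finset (V → ℤ)) :
    ((X.filter fun c => ∀ i, ¬ E.Sat c i).card : ℤ)
      = ∑ A ∈ E.nbcSets, (-1) ^ A.card * ((X.filter fun c => ∀ i ∈ A, E.Sat c i).card : ℤ) := by
  simp_rw [Finset.card_filter, Nat.cast_sum, Finset.mul_sum]
  rw [Finset.sum_comm]
  refine Finset.sum_congr rfl fun c _ => ?_
  have := E.sum_nbcSets_neg_one_pow hE c
  rw [Finset.sum_filter] at this
  push_cast
  rw [← this]
  exact Finset.sum_congr rfl fun A _ => by split_ifs <;> simp

end Whitney

end SignedEdges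

/-! ### Parametrizing the solutions of an independent set of constraints. -/

namespace SignedEdges

variable {V ι : Type*}

/-- The solutions of the constraints in `A` are the vectors `c` with `c x = s x * c (ρ x)`, where
`s x ∈ {0, 1, -1}` and `ρ` maps every vertex with `s x ≠ 0` to one of the free vertices `R`. -/
structure IsParam (E : SignedEdges V ι) (A : Finset ι) (R : Finset V) (ρ : V → V) (s : V → ℤ) :
    Prop where
  root : ∀ r ∈ R, ρ r = r ∧ s r = 1
  val : ∀ x, s x = 0 ∨ ((s x = 1 ∨ s x = -1) ∧ ρ x ∈ R)
  sat_iff : ∀ c, (∀ i ∈ A, E.Sat c i) ↔ ∀ x, c x = s x * c (ρ x)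

/-- The part of the list at `src i` that is matched by the list at `tgt i`. -/
def matched (E : SignedEdges V ι) (L : V → Finset ℤ) (i : ι) : Finset ℤ :=
  (L (E.src i)).filter fun a => (E.sgn i : ℤ) * a ∈ L (E.tgt i)

/-- The number of colours at `src i` that are not matched at `tgt i`, for lists of size `k`. -/
def defect (E : SignedEdges V ι) (k : ℕ) (L : V → Finset ℤ) (i : ι) : ℤ :=
  k - (E.matched L i).card

theorem defect_nonneg (E : SignedEdges V ι) {k : ℕ} {L : V → Finset ℤ}
    (hL : ∀ v, (L v).card = k) (i : ι) : 0 ≤ E.defect k L i := by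
  have h : (E.matched L i).card ≤ (L (E.src i)).card := Finset.card_le_card (Finset.filter_subset _ _)
  have := hL (E.src i)
  unfold defect
  omega

theorem sgn_eq_or (E : SignedEdges V ι) (i : ι) : (E.sgn i : ℤ) = 1 ∨ (E.sgn i : ℤ) = -1 := by
  rcases Int.units_eq_one_or (E.sgn i) with h | h <;> simp [h]

variable [DecidableEq V]

/-- Redirect everything attached to `r'` to `r`, scaled by `τ`. -/
theorem IsParam.update [DecidableEq ι] {E : SignedEdges V ι} {A : Finset ι} {R : Finset V}
    {ρ : V → V} {s : V → ℤ} (h : E.IsParam A R ρ s) {i : ι} {r r' : V} {τ : ℤ} (hr' : r' ∈ R)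
    (hτ : τ = 0 ∨ ((τ = 1 ∨ τ = -1) ∧ r ∈ R ∧ r ≠ r'))
    (hi : ∀ c : V → ℤ, (∀ x, c x = s x * c (ρ x)) → (E.Sat c i ↔ c r' = τ * c r)) :
    E.IsParam (insert i A) (R.erase r') (fun x => if ρ x = r' then r else ρ x)
      (fun x => if ρ x = r' then s x * τ else s x) where
  root x hx := by
    obtain ⟨hx1, hx2⟩ := Finset.mem_erase.1 hx
    obtain ⟨h1, h2⟩ := h.root x hx2
    simp [h1, h2, hx1]
  val x := by
    by_cases hx : ρ x = r'
    · simp only [hx, if_true]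
      rcases hτ with rfl | ⟨ht, hr⟩
      · simp
      · rcases h.val x with h0 | ⟨h0, -⟩
        · simp [h0]
        · right
          refine ⟨?_, Finset.mem_erase.2 ⟨hr.2, hr.1⟩⟩
          rcases h0 with h0 | h0 <;> rcases ht with ht | ht <;> simp [h0, ht]
    · simp only [hx, if_false]
      rcases h.val x with h0 | ⟨h0, h1⟩
      · exact Or.inl h0
      · exact Or.inr ⟨h0, Finset.mem_erase.2 ⟨hx, h1⟩⟩
  sat_iff c := by
    have : (∀ j ∈ insert i A, E.Sat c j) ↔ (∀ x, c x = s x * c (ρ x)) ∧ c r' = τ * c r := by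
      rw [Finset.forall_mem_insert, h.sat_iff]
      constructor
      · rintro ⟨h1, h2⟩
        exact ⟨h2, (hi c h2).1 h1⟩
      · rintro ⟨h1, h2⟩
        exact ⟨(hi c h1).2 h2, h1⟩
    rw [this]
    constructor
    · rintro ⟨h1, h2⟩ x
      by_cases hx : ρ x = r'
      · simp only [hx, if_true]
        rw [h1 x, hx, h2, mul_assoc]
      · simpa only [hx, if_false] using h1 x
    · intro h1
      have h2 : c r' = τ * c r := by
        have := h1 r'
        simpa [h.root r' hr'] using this
      refine ⟨fun x => ?_, h2⟩
      have := h1 x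
      by_cases hx : ρ x = r'
      · simp only [hx, if_true] at this
        rw [this, hx, h2, mul_assoc]
      · simpa only [hx, if_false] using this

variable [Fintype V]

/-- The colours that the free vertex `r` may take. -/
def fibre (L : V → Finset ℤ) (ρ : V → V) (s : V → ℤ) (r : V) : Finset ℤ :=
  (L r).filter fun a => ∀ x, ρ x = r → s x ≠ 0 → s x * a ∈ L x

theorem fibre_subset (L : V → Finset ℤ) (ρ : V → V) (s : V → ℤ) (r : V) :
    fibre L ρ s r ⊆ L r := Finset.filter_subset _ _

theorem card_fibre_le {k : ℕ} {L : V → Finset ℤ} (hL : ∀ v, (L v).card = k) (ρ : V → V)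
    (s : V → ℤ) (r : V) : (fibre L ρ s r).card ≤ k :=
  hL r ▸ Finset.card_le_card (fibre_subset L ρ s r)

theorem fibre_update_of_ne (L : V → Finset ℤ) (ρ : V → V) (s : V → ℤ) {r r' x : V} (τ : ℤ)
    (hr : x ≠ r) (hr' : x ≠ r') :
    fibre L (fun x => if ρ x = r' then r else ρ x) (fun x => if ρ x = r' then s x * τ else s x) x
      = fibre L ρ s x := by
  unfold fibre
  refine Finset.filter_congr fun a _ => forall_congr' fun y => ?_
  by_cases hy : ρ y = r'
  · simp only [hy, if_true]
    exact ⟨fun _ h => absurd h.symm hr', fun _ h => absurd h.symm hr⟩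
  · simp only [hy, if_false]

/-- When the class of `tgt i` is merged into that of `src i`, a color of the surviving root is lost
for one of two reasons. Its value at `src i` is unmatched, which costs at most the defect; or the
partner at `tgt i` does not come from the fibre `Y` of the other root, which costs at most `k -
|Y|`. -/
theorem card_fibre_update {E : SignedEdges V ι} {A : Finset ι} {R : Finset V}
    {ρ : V → V} {s : V → ℤ} (h : E.IsParam A R ρ s) {i : ι} {k : ℕ} {L : V → Finset ℤ}
    (hL : ∀ v, (L v).card = k)
    (hu : s (E.src i) ≠ 0) (hv : s (E.tgt i) ≠ 0) :
    ((fibre L ρ s (ρ (E.src i))).card : ℤ) ≤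
      (fibre L (fun x => if ρ x = ρ (E.tgt i) then ρ (E.src i) else ρ x)
        (fun x => if ρ x = ρ (E.tgt i) then s x * (s (E.tgt i) * E.sgn i * s (E.src i)) else s x)
        (ρ (E.src i))).card
      + (k - (fibre L ρ s (ρ (E.tgt i))).card) + E.defect k L i := by
  set u := E.src i
  set v := E.tgt i
  set σ : ℤ := (E.sgn i : ℤ)
  set F := fibre L (fun x => if ρ x = ρ v then ρ u else ρ x)
        (fun x => if ρ x = ρ v then s x * (s v * σ * s u) else s x) (ρ u) with hF
  set X := fibre L ρ s (ρ u) with hX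
  set Y := fibre L ρ s (ρ v) with hY
  have hσ : σ = 1 ∨ σ = -1 := E.sgn_eq_or i
  have hsu : s u = 1 ∨ s u = -1 := ((h.val u).resolve_left hu).1
  have hsv : s v = 1 ∨ s v = -1 := ((h.val v).resolve_left hv).1
  have hsplit : X ⊆ F ∪ (X.filter (fun a => s u * a ∉ E.matched L i) ∪
      X.filter (fun a => s u * a ∈ E.matched L i ∧ s v * σ * s u * a ∉ Y)) := by
    intro a ha
    simp only [Finset.mem_union, Finset.mem_filter]
    by_cases h1 : s u * a ∈ E.matched L i
    · by_cases h2 : s v * σ * s u * a ∈ Y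
      · left
        simp only [hF, hX, hY, fibre, Finset.mem_filter] at ha h2 ⊢
        refine ⟨ha.1, fun x hx hsx => ?_⟩
        by_cases hxv : ρ x = ρ v
        · simp only [hxv, if_true] at hsx ⊢
          rw [mul_assoc]
          exact h2.2 x hxv (left_ne_zero_of_mul hsx)
        · simp only [hxv, if_false] at hx hsx ⊢
          exact ha.2 x hx hsx
      · exact Or.inr (Or.inr ⟨ha, h1, h2⟩)
    · exact Or.inr (Or.inl ⟨ha, h1⟩)
  have hb1 : (X.filter (fun a => s u * a ∉ E.matched L i)).card ≤
      (L u \ E.matched L i).card := by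
    refine Finset.card_le_card_of_injOn (fun a => s u * a) ?_ ?_
    · intro a ha
      simp only [Finset.coe_filter, Set.mem_ofPred_eq, hX, fibre, Finset.mem_filter] at ha
      simp only [Finset.coe_sdiff, Set.mem_sdiff, Finset.mem_coe]
      exact ⟨ha.1.2 u rfl hu, ha.2⟩
    · intro a _ b _ hab
      exact mul_left_cancel₀ hu hab
  have hb2 : (X.filter (fun a => s u * a ∈ E.matched L i ∧ s v * σ * s u * a ∉ Y)).card ≤
      (L v \ Y.image (fun a => s v * a)).card := by
    refine Finset.card_le_card_of_injOn (fun a => σ * (s u * a)) ?_ ?_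
    · intro a ha
      simp only [Finset.coe_filter, Set.mem_ofPred_eq] at ha
      simp only [Finset.coe_sdiff, Set.mem_sdiff, Finset.mem_coe]
      refine ⟨(Finset.mem_filter.1 ha.2.1).2, fun hmem => ha.2.2 ?_⟩
      obtain ⟨b, hb, hba⟩ := Finset.mem_image.1 hmem
      have : s v * σ * s u * a = b := by
        have : s v * σ * s u * a = s v * (σ * (s u * a)) := by ring
        rw [this, ← hba]
        rcases hsv with h | h <;> simp [h]
      rwa [this]
    · intro a _ b _ hab
      have hσ0 : σ ≠ 0 := by rcases hσ with h | h <;> simp [h]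
      exact mul_left_cancel₀ hu (mul_left_cancel₀ hσ0 hab)
  have hc1 : (L u \ E.matched L i).card + (E.matched L i).card = (L u).card :=
    Finset.card_sdiff_add_card_eq_card (Finset.filter_subset _ _)
  have hYv : Y.image (fun a => s v * a) ⊆ L v := by
    intro b hb
    obtain ⟨a, ha, rfl⟩ := Finset.mem_image.1 hb
    exact (Finset.mem_filter.1 ha).2 v rfl hv
  have hc2 := Finset.card_sdiff_add_card_eq_card hYv
  rw [Finset.card_image_of_injective _ fun a b hab => mul_left_cancel₀ hv hab] at hc2
  have hc3 := (Finset.card_le_card hsplit).trans (Finset.card_union_le _ _)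
  have hc4 := Finset.card_union_le (X.filter (fun a => s u * a ∉ E.matched L i))
      (X.filter (fun a => s u * a ∈ E.matched L i ∧ s v * σ * s u * a ∉ Y))
  have := hL u
  have := hL v
  unfold defect
  omega

/-- A set of constraints is parametrized by `R`, losing few colours. -/
structure IsGoodParam (E : SignedEdges V ι) (k : ℕ) (L : V → Finset ℤ) (A : Finset ι)
    (R : Finset V) (ρ : V → V) (s : V → ℤ) : Prop extends E.IsParam A R ρ s where
  card_add : R.card + A.card = Fintype.card V
  sum_le : ∑ r ∈ R, ((k : ℤ) - (fibre L ρ s r).card) ≤ ∑ i ∈ A, E.defect k L i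

/-- A constraint not implied by `A` removes exactly one root: it either forces a root to `0` or
merges two distinct roots. -/
theorem IsGoodParam.exists_insert [DecidableEq ι] {E : SignedEdges V ι} {k : ℕ} {L : V → Finset ℤ}
    (hL : ∀ v, (L v).card = k) {A : Finset ι} {R : Finset V} {ρ : V → V} {s : V → ℤ}
    (h : E.IsGoodParam k L A R ρ s) {i : ι} (hiA : i ∉ A) (hi : ¬ E.Implies A i) :
    ∃ R' ρ' s', E.IsGoodParam k L (insert i A) R' ρ' s' := by
  obtain ⟨c, hcA, hci⟩ : ∃ c : V → ℤ, (∀ x, c x = s x * c (ρ x)) ∧ ¬ E.Sat c i := by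
    unfold Implies at hi
    push Not at hi
    obtain ⟨c, h1, h2⟩ := hi
    exact ⟨c, (h.sat_iff c).1 h1, h2⟩
  have hσ := E.sgn_eq_or i
  have hcard : ∀ r' ∈ R, (R.erase r').card + (insert i A).card = Fintype.card V := by
    intro r' hr'
    rw [Finset.card_insert_of_notMem hiA, ← h.card_add, ← Finset.card_erase_add_one hr']
    ring
  have hterm : ∀ r, 0 ≤ (k : ℤ) - (fibre L ρ s r).card := fun r => by
    have := card_fibre_le hL ρ s r
    omega
  -- A root forced to `0` leaves the index set with its nonnegative term, so the bound survives
  -- without using the new defect.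
  have kill : ∀ r' ∈ R, (∀ c : V → ℤ, (∀ x, c x = s x * c (ρ x)) → (E.Sat c i ↔ c r' = 0)) →
      ∃ R' ρ' s', E.IsGoodParam k L (insert i A) R' ρ' s' := by
    intro r' hr' hsat
    refine ⟨_, _, _, h.toIsParam.update (i := i) (r := r') (τ := 0) hr' (Or.inl rfl)
      (by simpa using hsat), hcard r' hr', ?_⟩
    rw [Finset.sum_insert hiA, Finset.sum_congr rfl fun x hx => by
      rw [fibre_update_of_ne L ρ s 0 (Finset.ne_of_mem_erase hx) (Finset.ne_of_mem_erase hx)]]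
    have h1 := Finset.add_sum_erase R (fun r => (k : ℤ) - (fibre L ρ s r).card) hr'
    have h2 := h.sum_le
    have h3 := hterm r'
    have h4 := E.defect_nonneg hL i
    linarith
  have hsat : ∀ c : V → ℤ, (∀ x, c x = s x * c (ρ x)) → (E.Sat c i ↔
      s (E.src i) * c (ρ (E.src i)) = E.sgn i * (s (E.tgt i) * c (ρ (E.tgt i)))) := by
    intro c hc
    unfold Sat
    rw [← hc, ← hc]
  rw [hsat c hcA] at hci
  rcases h.val (E.src i) with hu | ⟨hu, huR⟩
  · rcases h.val (E.tgt i) with hv | ⟨hv, hvR⟩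
    · exact absurd (by simp [hu, hv]) hci
    · refine kill _ hvR fun c hc => ?_
      rw [hsat c hc, hu]
      rcases hσ with h1 | h1 <;> rcases hv with h2 | h2 <;> rw [h1, h2] <;> omega
  · rcases h.val (E.tgt i) with hv | ⟨hv, hvR⟩
    · refine kill _ huR fun c hc => ?_
      rw [hsat c hc, hv]
      rcases hu with h2 | h2 <;> rw [h2] <;> simp
    -- With a common root the constraint reads `c r = ± c r`; the witness in `hci` rules out the
    -- plus sign, so `c r = 0`.
    · by_cases hne : ρ (E.src i) = ρ (E.tgt i)
      · refine kill _ huR fun c hc => ?_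
        rw [hsat c hc, ← hne]
        rw [← hne] at hci
        rcases hσ with h1 | h1 <;> rcases hv with h2 | h2 <;> rcases hu with h3 | h3 <;>
          rw [h1, h2, h3] at hci ⊢ <;> omega
      · have hu0 : s (E.src i) ≠ 0 := by rcases hu with h | h <;> simp [h]
        have hv0 : s (E.tgt i) ≠ 0 := by rcases hv with h | h <;> simp [h]
        refine ⟨_, _, _, h.toIsParam.update (i := i) (r := ρ (E.src i))
          (τ := s (E.tgt i) * E.sgn i * s (E.src i)) hvR (Or.inr ⟨?_, huR, hne⟩) ?_,
          hcard _ hvR, ?_⟩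
        · rcases hσ with h1 | h1 <;> rcases hv with h2 | h2 <;> rcases hu with h3 | h3 <;>
            simp [h1, h2, h3]
        · intro c hc
          rw [hsat c hc]
          rcases hσ with h1 | h1 <;> rcases hv with h2 | h2 <;> rcases hu with h3 | h3 <;>
            rw [h1, h2, h3] <;> omega
        · have huR' := Finset.mem_erase.2 ⟨hne, huR⟩
          rw [Finset.sum_insert hiA, ← Finset.add_sum_erase _ _ huR',
            Finset.sum_congr rfl fun x hx => by
              rw [fibre_update_of_ne L ρ s _ (Finset.ne_of_mem_erase hx)
                (Finset.ne_of_mem_erase (Finset.mem_of_mem_erase hx))]]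
          have h0 := card_fibre_update h.toIsParam hL hu0 hv0
          have h1 := Finset.add_sum_erase R (fun r => (k : ℤ) - (fibre L ρ s r).card) hvR
          have h2 := Finset.add_sum_erase _ (fun r => (k : ℤ) - (fibre L ρ s r).card) huR'
          have h3 := h.sum_le
          linarith

/-- Constraints are added in decreasing order: the broken circuit condition at the new minimum says
precisely that the earlier ones do not imply it. -/
theorem NoBrokenCircuit.exists_isGoodParam [LinearOrder ι] {E : SignedEdges V ι} {k : ℕ}
    {L : V → Finset ℤ} (hL : ∀ v, (L v).card = k) {A : Finset ι} (hA : E.NoBrokenCircuit A) :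
    ∃ R ρ s, E.IsGoodParam k L A R ρ s := by
  induction A using Finset.induction_on_min with
  | empty =>
    refine ⟨Finset.univ, id, fun _ => 1, ⟨by simp, by simp, by simp⟩, by simp, ?_⟩
    rw [Finset.sum_empty]
    refine Finset.sum_nonpos fun r _ => ?_
    have : fibre L id (fun _ => 1) r = L r := by
      refine Finset.filter_true_of_mem fun a ha x hx _ => ?_
      obtain rfl : x = r := hx
      simpa using ha
    simp [this, hL]
  | insert a A hmin ih =>
    obtain ⟨R, ρ, s, h⟩ := ih (hA.mono (Finset.subset_insert _ _))
    refine h.exists_insert hL (fun ha => lt_irrefl _ (hmin a ha)) ?_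
    have := hA a
    rwa [Finset.filter_insert, if_neg (lt_irrefl a), Finset.filter_true_of_mem hmin] at this

end SignedEdges

/-! ### Comparing solution counts for `L` and for a symmetric list `M`. -/

namespace SignedEdges

variable {V ι : Type*} [DecidableEq V] [Fintype V]

/-- The number of choices of colours from the lists that satisfy all constraints in `A`. -/
def solCount (E : SignedEdges V ι) (L : V → Finset ℤ) (A : Finset ι) : ℕ :=
  ((Fintype.piFinset L).filter fun c => ∀ i ∈ A, E.Sat c i).card

/-- The roots take values independently in their fibres and determine everything else; `h0` admits
the vertices forced to `0`. -/
theorem IsParam.solCount_eq_prod {E : SignedEdges V ι} {A : Finset ι} {R : Finset V} {ρ : V → V}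
    {s : V → ℤ} (h : E.IsParam A R ρ s) {L : V → Finset ℤ} (h0 : ∀ x, s x = 0 → 0 ∈ L x) :
    E.solCount L A = ∏ r ∈ R, (fibre L ρ s r).card := by
  classical
  rw [← Finset.prod_coe_sort, ← Fintype.card_piFinset]
  refine Finset.card_nbij' (fun c r => c r)
    (fun g x => s x * if hx : ρ x ∈ R then g ⟨ρ x, hx⟩ else 0) ?_ ?_ ?_ ?_
  · intro c hc
    simp only [Finset.coe_filter, Set.mem_ofPred_eq, Fintype.mem_piFinset, h.sat_iff] at hc
    simp only [Finset.mem_coe, Fintype.mem_piFinset, fibre, Finset.mem_filter]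
    rintro ⟨r, hr⟩
    refine ⟨hc.1 r, fun x hx _ => ?_⟩
    rw [← hx, ← hc.2 x]
    exact hc.1 x
  · intro g hg
    simp only [Finset.mem_coe, Fintype.mem_piFinset, fibre, Finset.mem_filter] at hg
    simp only [Finset.coe_filter, Set.mem_ofPred_eq, Fintype.mem_piFinset, h.sat_iff]
    refine ⟨fun x => ?_, fun x => ?_⟩
    · rcases h.val x with hx | ⟨hx, hxR⟩
      · simpa [hx] using h0 x hx
      · rw [dif_pos hxR]
        exact (hg ⟨ρ x, hxR⟩).2 x rfl (by rcases hx with hx | hx <;> simp [hx])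
    · rcases h.val x with hx | ⟨hx, hxR⟩
      · simp [hx]
      · simp [hxR, h.root _ hxR]
  · intro c hc
    simp only [Finset.coe_filter, Set.mem_ofPred_eq, Fintype.mem_piFinset, h.sat_iff] at hc
    funext x
    rcases h.val x with hx | ⟨hx, hxR⟩
    · have h1 := hc.2 x
      rw [hx, zero_mul] at h1
      simp [hx, h1]
    · simp only [hxR, dif_pos]
      exact (hc.2 x).symm
  · intro g _
    funext ⟨r, hr⟩
    simp [h.root r hr, hr]

theorem IsParam.solCount_eq_zero {E : SignedEdges V ι} {A : Finset ι} {R : Finset V} {ρ : V → V}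
    {s : V → ℤ} (h : E.IsParam A R ρ s) {L : V → Finset ℤ} {x : V} (hx : s x = 0)
    (h0 : 0 ∉ L x) : E.solCount L A = 0 := by
  refine Finset.card_eq_zero.2 (Finset.filter_eq_empty_iff.2 fun c hc hs => h0 ?_)
  have := (h.sat_iff c).1 hs x
  rw [hx, zero_mul] at this
  rw [← this]
  exact Fintype.mem_piFinset.1 hc x

theorem IsParam.fibre_const {E : SignedEdges V ι} {A : Finset ι} {R : Finset V} {ρ : V → V}
    {s : V → ℤ} (h : E.IsParam A R ρ s) {M : Finset ℤ} (hM : ∀ a ∈ M, -a ∈ M) (r : V) :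
    fibre (fun _ => M) ρ s r = M := by
  refine Finset.filter_true_of_mem fun a ha x _ hx => ?_
  rcases ((h.val x).resolve_left hx).1 with h1 | h1
  · simpa [h1] using ha
  · simpa [h1] using hM a ha

/-- The Weierstrass inequality `∏ (1 - x_r) ≥ 1 - ∑ x_r` with `x_r = 1 - f r / k`, cleared of
denominators. -/
theorem pow_card_mul_le_mul_prod {α : Type*} (R : Finset α) (k : ℝ) (hk : 0 ≤ k) (f : α → ℝ)
    (hf : ∀ r ∈ R, 0 ≤ f r ∧ f r ≤ k) :
    k ^ R.card * (k - ∑ r ∈ R, (k - f r)) ≤ k * ∏ r ∈ R, f r := by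
  classical
  induction R using Finset.induction_on with
  | empty => simp
  | insert a R ha ih =>
    have ih := ih fun r hr => hf r (Finset.mem_insert_of_mem hr)
    have h1 := hf a (Finset.mem_insert_self _ _)
    have h2 : ∏ r ∈ R, f r ≤ k ^ R.card := by
      rw [← Finset.prod_const]
      exact Finset.prod_le_prod (fun r hr => (hf r (Finset.mem_insert_of_mem hr)).1)
        fun r hr => (hf r (Finset.mem_insert_of_mem hr)).2
    rw [Finset.card_insert_of_notMem ha, Finset.sum_insert ha, Finset.prod_insert ha, pow_succ]
    have h3 := mul_le_mul_of_nonneg_left ih hk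
    have h4 := mul_le_mul_of_nonneg_left h2 (mul_nonneg hk (sub_nonneg.2 h1.2))
    linarith

variable {E : SignedEdges V ι} {k : ℕ} {L : V → Finset ℤ} {M : Finset ℤ}

theorem IsGoodParam.solCount_compare (hL : ∀ v, (L v).card = k) (hM : ∀ a ∈ M, -a ∈ M)
    (hMk : M.card = k) (h0 : ∀ v, 0 ∈ L v ↔ 0 ∈ M) {A : Finset ι} {R : Finset V} {ρ : V → V}
    {s : V → ℤ} (h : E.IsGoodParam k L A R ρ s) :
    E.solCount L A ≤ E.solCount (fun _ => M) A ∧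
      (k : ℝ) * (E.solCount (fun _ => M) A - E.solCount L A) ≤
        (k : ℝ) ^ R.card * ∑ i ∈ A, (E.defect k L i : ℝ) := by
  -- By `h0`, a vertex forced to `0` makes both counts vanish or obstructs neither. Otherwise
  -- symmetry of `M` makes all its fibres full.
  by_cases hx : ∃ x, s x = 0 ∧ 0 ∉ M
  · obtain ⟨x, hx, hxM⟩ := hx
    rw [h.solCount_eq_zero hx (L := fun _ => M) hxM, h.solCount_eq_zero hx (mt (h0 x).1 hxM)]
    refine ⟨le_rfl, ?_⟩
    have : (0 : ℝ) ≤ ∑ i ∈ A, (E.defect k L i : ℝ) :=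
      Finset.sum_nonneg fun i _ => by exact_mod_cast E.defect_nonneg hL i
    simp only [Nat.cast_zero, sub_zero, mul_zero]
    positivity
  · push Not at hx
    rw [h.solCount_eq_prod (L := fun _ => M) hx, h.solCount_eq_prod fun x hs => (h0 x).2 (hx x hs)]
    simp_rw [h.fibre_const hM, hMk, Finset.prod_const]
    refine ⟨Finset.prod_le_pow_card _ _ _ fun r _ => card_fibre_le hL ρ s r, ?_⟩
    have h1 := pow_card_mul_le_mul_prod R (k : ℝ) (Nat.cast_nonneg k)
      (fun r => ((fibre L ρ s r).card : ℝ))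
      fun r _ => ⟨Nat.cast_nonneg _, Nat.cast_le.2 (card_fibre_le hL ρ s r)⟩
    have h2 : ∑ r ∈ R, ((k : ℝ) - (fibre L ρ s r).card) ≤ ∑ i ∈ A, (E.defect k L i : ℝ) := by
      exact_mod_cast h.sum_le
    have h3 := mul_le_mul_of_nonneg_left h2 (pow_nonneg (Nat.cast_nonneg (α := ℝ) k) R.card)
    push_cast
    linarith

/-- One edge leaves `k^(n-1)` solutions for `M`, but at most `|matched| * k^(n-2)` for `L`. The
factor `k^2` avoids the exponent `n - 2`. -/
theorem solCount_singleton_compare (hL : ∀ v, (L v).card = k) (hM : ∀ a ∈ M, -a ∈ M)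
    (hMk : M.card = k) {i : ι} (hi : E.src i ≠ E.tgt i) :
    (k : ℝ) ^ Fintype.card V * E.defect k L i ≤
      (k : ℝ) ^ 2 * (E.solCount (fun _ => M) {i} - E.solCount L {i}) := by
  classical
  have h0 : E.IsParam ∅ Finset.univ id (fun _ => 1) := ⟨by simp, by simp, by simp⟩
  have h := h0.update (i := i) (r := E.src i) (τ := (E.sgn i : ℤ)) (Finset.mem_univ (E.tgt i))
    (Or.inr ⟨E.sgn_eq_or i, Finset.mem_univ _, hi⟩) fun c _ => by
      unfold Sat
      rcases E.sgn_eq_or i with h | h <;> rw [h] <;> omega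
  rw [insert_empty_eq] at h
  set ρ : V → V := fun x => if id x = E.tgt i then E.src i else id x with hρ
  set s : V → ℤ := fun x => if id x = E.tgt i then 1 * (E.sgn i : ℤ) else 1 with hs
  have hs0 : ∀ x, s x ≠ 0 := by
    intro x
    simp only [hs, one_mul]
    split_ifs
    · exact Units.ne_zero _
    · exact one_ne_zero
  rw [h.solCount_eq_prod (L := fun _ => M) fun x hx => absurd hx (hs0 x),
    h.solCount_eq_prod (L := L) fun x hx => absurd hx (hs0 x)]
  simp_rw [h.fibre_const hM, hMk]
  have hsrc : E.src i ∈ Finset.univ.erase (E.tgt i) := by simpa using hi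
  have hfib : (fibre L ρ s (E.src i)).card ≤ (E.matched L i).card := by
    refine Finset.card_le_card fun a ha => ?_
    obtain ⟨h1, h2⟩ := Finset.mem_filter.1 ha
    refine Finset.mem_filter.2 ⟨h1, ?_⟩
    simpa [hs] using h2 (E.tgt i) (by simp [hρ]) (hs0 _)
  have hn : ((Finset.univ.erase (E.tgt i)).erase (E.src i)).card + 2 = Fintype.card V := by
    have h1 := Finset.card_erase_add_one hsrc
    have h2 := Finset.card_erase_add_one (Finset.mem_univ (E.tgt i))
    rw [Finset.card_univ] at h2
    omega
  have hprod : (∏ r ∈ (Finset.univ.erase (E.tgt i)).erase (E.src i), (fibre L ρ s r).card) ≤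
      k ^ ((Finset.univ.erase (E.tgt i)).erase (E.src i)).card :=
    Finset.prod_le_pow_card _ _ _ fun r _ => card_fibre_le hL ρ s r
  rw [← Finset.mul_prod_erase _ (fun r => (fibre L ρ s r).card) hsrc,
    ← Finset.mul_prod_erase _ (fun _ => k) hsrc, Finset.prod_const, ← hn]
  have hle : (((fibre L ρ s (E.src i)).card *
      ∏ r ∈ (Finset.univ.erase (E.tgt i)).erase (E.src i), (fibre L ρ s r).card : ℕ) : ℝ) ≤
      (((E.matched L i).card * k ^ ((Finset.univ.erase (E.tgt i)).erase (E.src i)).card : ℕ) : ℝ) :=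
    Nat.cast_le.2 (Nat.mul_le_mul hfib hprod)
  have := mul_le_mul_of_nonneg_left hle (sq_nonneg (k : ℝ))
  unfold defect
  push_cast at this ⊢
  rw [pow_add]
  linarith

end SignedEdges

/-! ### Summing the comparison over all sets without broken circuits. -/

namespace SignedEdges

variable {V ι : Type*}

/-- No loops and no parallel constraints. -/
def Simple (E : SignedEdges V ι) : Prop :=
  (∀ i, E.src i ≠ E.tgt i) ∧ ∀ i j, s(E.src i, E.tgt i) = s(E.src j, E.tgt j) → i = j

/-- Some endpoint of `i` is not on `j`; the indicator vector of that vertex satisfies `j` and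
violates `i`. -/
theorem Simple.not_implies_singleton [DecidableEq V] {E : SignedEdges V ι} (hE : E.Simple)
    {i j : ι} (hij : i ≠ j) : ¬ E.Implies {j} i := by
  intro h
  obtain ⟨x, hx, hxj⟩ : ∃ x, (x = E.src i ∨ x = E.tgt i) ∧ x ≠ E.src j ∧ x ≠ E.tgt j := by
    by_contra! hc
    have h1 := hc _ (Or.inl rfl)
    have h2 := hc _ (Or.inr rfl)
    refine hij (hE.2 i j (Sym2.eq_iff.2 ?_))
    have := hE.1 i
    by_cases h3 : E.src i = E.src j
    · by_cases h4 : E.tgt i = E.src j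
      · exact absurd (h3.trans h4.symm) this
      · exact Or.inl ⟨h3, h2 h4⟩
    · by_cases h4 : E.tgt i = E.src j
      · exact Or.inr ⟨h1 h3, h4⟩
      · exact absurd ((h1 h3).trans (h2 h4).symm) this
  have hs := h (Pi.single x 1) (by
    intro l hl
    obtain rfl := Finset.mem_singleton.1 hl
    simp [Sat, Pi.single_eq_of_ne hxj.1.symm, Pi.single_eq_of_ne hxj.2.symm])
  unfold Sat at hs
  have hne := hE.1 i
  rcases hx with rfl | rfl
  · simp [Pi.single_eq_of_ne hne.symm] at hs
  · simp only [Pi.single_eq_of_ne hne, Pi.single_eq_same, mul_one] at hs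
    exact Units.ne_zero _ hs.symm

theorem Simple.not_implies_empty [DecidableEq V] {E : SignedEdges V ι} (hE : E.Simple) (i : ι) :
    ¬ E.Implies ∅ i := by
  intro h
  have := h (Pi.single (E.src i) 1) (by simp)
  unfold Sat at this
  simp [Pi.single_eq_of_ne (hE.1 i).symm] at this

theorem Simple.noBrokenCircuit_singleton [DecidableEq V] [LinearOrder ι] {E : SignedEdges V ι}
    (hE : E.Simple) (i : ι) : E.NoBrokenCircuit {i} := by
  intro j hj
  rw [Finset.filter_singleton] at hj
  split_ifs at hj with h
  · exact hE.not_implies_singleton h.ne hj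
  · exact hE.not_implies_empty j hj

/-- The coefficient with which a set of `j + 1` constraints enters the lower bound. -/
noncomputable def weight (y : ℝ) (j : ℕ) : ℝ :=
  (if j = 0 then 1 else 0) - (y ^ j - (-y) ^ j) / 2

theorem weight_even {y : ℝ} {j : ℕ} (hj : Even j) : weight y j = if j = 0 then 1 else 0 := by
  simp [weight, hj.neg_pow]

theorem weight_odd {y : ℝ} {j : ℕ} (hj : Odd j) : weight y j = - y ^ j := by
  have : j ≠ 0 := by rintro rfl; simp at hj
  simp [weight, hj.neg_pow, this]

theorem weight_nonpos {y : ℝ} (hy : 0 ≤ y) {j : ℕ} (hj : j ≠ 0) : weight y j ≤ 0 := by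
  rcases Nat.even_or_odd j with h | h
  · simp [weight_even h, hj]
  · rw [weight_odd h]
    have := pow_nonneg hy j
    linarith

theorem sum_powerset_weight {α : Type*} (s : Finset α) (y : ℝ) :
    ∑ B ∈ s.powerset, weight y B.card = 1 - ((1 + y) ^ s.card - (1 - y) ^ s.card) / 2 := by
  have h : ∀ z : ℝ, ∑ B ∈ s.powerset, z ^ B.card = (1 + z) ^ s.card := fun z => by
    have := Finset.sum_pow_mul_eq_add_pow z 1 s
    simpa [add_comm] using this
  unfold weight
  rw [Finset.sum_sub_distrib, ← Finset.sum_div, Finset.sum_sub_distrib, h, h, ← sub_eq_add_neg]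
  rw [Finset.sum_eq_single_of_mem ∅ (Finset.empty_mem_powerset s) fun B _ hB => by
    rw [if_neg (mt Finset.card_eq_zero.1 hB)]]
  simp

theorem sum_mem_weight [Fintype ι] [DecidableEq ι] (i : ι) (y : ℝ) :
    ∑ A : Finset ι with i ∈ A, weight y (A.card - 1)
      = 1 - ((1 + y) ^ (Fintype.card ι - 1) - (1 - y) ^ (Fintype.card ι - 1)) / 2 := by
  have hc : (Finset.univ.erase i).card = Fintype.card ι - 1 := by
    rw [Finset.card_erase_of_mem (Finset.mem_univ i), Finset.card_univ]
  rw [← hc, ← sum_powerset_weight]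
  refine Finset.sum_nbij' (fun A => A.erase i) (fun B => insert i B) ?_ ?_ ?_ ?_ ?_
  · intro A _
    exact Finset.mem_powerset.2 (Finset.erase_subset_erase _ (Finset.subset_univ _))
  · intro B _
    simp
  · intro A hA
    exact Finset.insert_erase (Finset.mem_filter.1 hA).2
  · intro B hB
    exact Finset.erase_insert fun h => by simpa using Finset.mem_powerset.1 hB h
  · intro A hA
    rw [Finset.card_erase_of_mem (Finset.mem_filter.1 hA).2]

variable [DecidableEq V] [Fintype V] [LinearOrder ι] {E : SignedEdges V ι} {k : ℕ}
  {L : V → Finset ℤ} {M : Finset ℤ}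

/-- With `j = |A| - 1`, the weight is `1` for the singleton gain, `0` for larger odd sets, whose
contribution is merely nonnegative, and `-k^(-j)` for the possible loss of a nonempty even set. -/
theorem weight_mul_sum_defect_le (hE : E.Simple) (hk : 0 < k) (hL : ∀ v, (L v).card = k)
    (hM : ∀ a ∈ M, -a ∈ M) (hMk : M.card = k) (h0 : ∀ v, 0 ∈ L v ↔ 0 ∈ M) {A : Finset ι}
    (hA : E.NoBrokenCircuit A) :
    (k : ℝ) ^ Fintype.card V * (weight (k : ℝ)⁻¹ (A.card - 1) * ∑ i ∈ A, (E.defect k L i : ℝ)) ≤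
      (k : ℝ) ^ 2 * ((-1) ^ A.card * (E.solCount L A - E.solCount (fun _ => M) A)) := by
  obtain ⟨R, ρ, s, h⟩ := hA.exists_isGoodParam hL
  obtain ⟨h1, h2⟩ := h.solCount_compare hL hM hMk h0
  have h1 : (E.solCount L A : ℝ) ≤ E.solCount (fun _ => M) A := Nat.cast_le.2 h1
  have hk' : (0 : ℝ) < k := Nat.cast_pos.2 hk
  -- For `A = ∅` truncated subtraction gives weight `1`, which multiplies an empty sum.
  rcases Nat.eq_zero_or_pos A.card with hc | hc
  · obtain rfl := Finset.card_eq_zero.1 hc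
    simp only [Finset.sum_empty, mul_zero] at h2 ⊢
    have := nonpos_of_mul_nonpos_right h2 hk'
    have : (E.solCount L ∅ : ℝ) - E.solCount (fun _ => M) ∅ = 0 := by linarith
    simp [this]
  · obtain ⟨j, hj⟩ : ∃ j, A.card = j + 1 := ⟨A.card - 1, by omega⟩
    rw [hj, Nat.add_sub_cancel]
    rcases Nat.even_or_odd j with hje | hjo
    · rw [weight_even hje, pow_succ (-1 : ℝ), hje.neg_one_pow]
      split_ifs with hj0
      · obtain ⟨i, rfl⟩ := Finset.card_eq_one.1 (by omega : A.card = 1)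
        have := solCount_singleton_compare hL hM hMk (hE.1 i)
        simp only [Finset.sum_singleton]
        linarith
      · have := mul_nonneg (sq_nonneg (k : ℝ)) (sub_nonneg.2 h1)
        linarith
    · have hV : (k : ℝ) ^ Fintype.card V * ((k : ℝ)⁻¹) ^ j = k * (k : ℝ) ^ R.card := by
        rw [← h.card_add, hj, pow_add, pow_succ, inv_pow]
        field_simp
      rw [weight_odd hjo, pow_succ (-1 : ℝ), hjo.neg_one_pow]
      have h3 := mul_le_mul_of_nonneg_left h2 hk'.le
      have h4 : (k : ℝ) ^ Fintype.card V * (-(k : ℝ)⁻¹ ^ j * ∑ i ∈ A, (E.defect k L i : ℝ)) =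
          - (k * (k : ℝ) ^ R.card * ∑ i ∈ A, (E.defect k L i : ℝ)) := by
        rw [← hV]; ring
      rw [h4]
      linarith

variable [Fintype ι]

/-- The number of list colourings violating no constraint. -/
def properCount (E : SignedEdges V ι) (L : V → Finset ℤ) : ℕ :=
  ((Fintype.piFinset L).filter fun c => ∀ i, ¬ E.Sat c i).card

theorem sum_defect_le (hE : E.Simple) (hk : 0 < k) (hL : ∀ v, (L v).card = k)
    (hM : ∀ a ∈ M, -a ∈ M) (hMk : M.card = k) (h0 : ∀ v, 0 ∈ L v ↔ 0 ∈ M) :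
    (k : ℝ) ^ Fintype.card V * ((1 - ((1 + (k : ℝ)⁻¹) ^ (Fintype.card ι - 1) -
        (1 - (k : ℝ)⁻¹) ^ (Fintype.card ι - 1)) / 2) * ∑ i, (E.defect k L i : ℝ)) ≤
      (k : ℝ) ^ 2 * (E.properCount L - E.properCount (fun _ => M)) := by
  have hP : ∀ L : V → Finset ℤ, (E.properCount L : ℝ) =
      ∑ A ∈ E.nbcSets, (-1) ^ A.card * (E.solCount L A : ℝ) := fun L => by
    have h : (E.properCount L : ℤ) = ∑ A ∈ E.nbcSets, (-1) ^ A.card * (E.solCount L A : ℤ) := by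
      unfold properCount solCount
      convert E.card_proper_eq_sum hE.not_implies_empty (Fintype.piFinset L)
    have h := congrArg (Int.cast : ℤ → ℝ) h
    push_cast at h
    exact h
  rw [hP, hP, ← Finset.sum_sub_distrib, Finset.mul_sum E.nbcSets]
  simp_rw [← mul_sub]
  refine le_trans ?_ (Finset.sum_le_sum fun A hA =>
    weight_mul_sum_defect_le hE hk hL hM hMk h0 (mem_nbcSets.1 hA))
  rw [← Finset.mul_sum]
  refine mul_le_mul_of_nonneg_left ?_ (by positivity)
  -- After exchanging sums, the coefficient of the defect of `i` is the total weight of all sets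
  -- containing `i`.
  calc _ = ∑ A : Finset ι, weight (k : ℝ)⁻¹ (A.card - 1) * ∑ i ∈ A, (E.defect k L i : ℝ) := by
        rw [Finset.mul_sum, Finset.sum_congr rfl fun i _ => by
          rw [← sum_mem_weight i, Finset.sum_mul, Finset.sum_filter], Finset.sum_comm]
        refine Finset.sum_congr rfl fun A _ => ?_
        rw [← Finset.sum_filter, Finset.mul_sum]
        simp
    _ ≤ _ := by
        -- Sets with broken circuits may be included: singletons have none, so only nonpositive
        -- terms are added.
        refine Finset.sum_le_sum_of_subset_of_nonpos' (Finset.subset_univ _) fun A _ hA => ?_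
        rcases Nat.eq_zero_or_pos A.card with hc | hc
        · simp [Finset.card_eq_zero.1 hc]
        · have h1 : A.card ≠ 1 := fun h1 => by
            obtain ⟨i, rfl⟩ := Finset.card_eq_one.1 h1
            exact hA (mem_nbcSets.2 (hE.noBrokenCircuit_singleton i))
          exact mul_nonpos_of_nonpos_of_nonneg (weight_nonpos (by positivity) (by omega))
            (Finset.sum_nonneg fun i _ => by exact_mod_cast E.defect_nonneg hL i)

theorem properCount_le_and_eq (hE : E.Simple) (hk : 0 < k) (hL : ∀ v, (L v).card = k)
    (hM : ∀ a ∈ M, -a ∈ M) (hMk : M.card = k) (h0 : ∀ v, 0 ∈ L v ↔ 0 ∈ M)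
    (hm : ((Fintype.card ι : ℝ) - 1) / Real.log (1 + Real.sqrt 2) < k) :
    E.properCount (fun _ => M) ≤ E.properCount L ∧
      (E.properCount L = E.properCount (fun _ => M) → ∀ i, E.defect k L i = 0) := by
  have hd : ∀ i, (0 : ℝ) ≤ E.defect k L i := fun i => by exact_mod_cast E.defect_nonneg hL i
  have hk' : (0 : ℝ) < k := Nat.cast_pos.2 hk
  have key := sum_defect_le hE hk hL hM hMk h0
  set S := ((1 + (k : ℝ)⁻¹) ^ (Fintype.card ι - 1) -
        (1 - (k : ℝ)⁻¹) ^ (Fintype.card ι - 1)) / 2 with hS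
  have hS1 : S < 1 := by
    refine (odd_part_one_add_pow_le_sinh _ (by positivity)).trans_lt (sinh_lt_one_of_lt_log ?_)
    have hlog : 0 < Real.log (1 + Real.sqrt 2) := Real.log_pos (by simp)
    -- Without edges the natural number `m - 1` is `0`, unlike the real `m - 1` in `hm`.
    rcases Nat.eq_zero_or_pos (Fintype.card ι) with h | h
    · simpa [h] using hlog
    · rw [Nat.cast_sub h, ← div_eq_mul_inv, div_lt_iff₀ hk']
      rw [div_lt_iff₀ hlog] at hm
      simpa [mul_comm] using hm
  have hsum : (0 : ℝ) ≤ ∑ i, (E.defect k L i : ℝ) := Finset.sum_nonneg fun i _ => hd i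
  constructor
  · have h1 : 0 ≤ (k : ℝ) ^ 2 * (E.properCount L - E.properCount (fun _ => M)) :=
      le_trans (mul_nonneg (by positivity) (mul_nonneg (by linarith) hsum)) key
    have h2 := nonneg_of_mul_nonneg_right h1 (by positivity)
    exact_mod_cast sub_nonneg.1 h2
  · intro heq i
    rw [heq, sub_self, mul_zero] at key
    have h1 := nonpos_of_mul_nonpos_right key (by positivity)
    have h2 := nonpos_of_mul_nonpos_right h1 (by linarith)
    have h3 := (Finset.sum_eq_zero_iff_of_nonneg fun i _ => hd i).1 (le_antisymm h2 hsum) i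
      (Finset.mem_univ i)
    exact_mod_cast h3

end SignedEdges

/-! ### Signed graphs as constraint systems, and the equality case. -/

namespace SignedGraph

variable {V : Type*}

theorem adjSign_eq_or (S : SignedGraph V) {u v : V} (h : S.graph.Adj u v) :
    S.adjSign h = 1 ∨ S.adjSign h = -1 := by
  unfold adjSign
  rcases Int.units_eq_one_or (S.sign ⟨s(u, v), h⟩) with h | h <;> simp [h]

theorem adjSign_eq_of_eq (S : SignedGraph V) {u v : V} (h : S.graph.Adj u v)
    {e : S.graph.edgeSet} (he : s(u, v) = (e : Sym2 V)) : S.adjSign h = S.sign e := by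
  obtain ⟨e, he'⟩ := e
  subst he
  rfl

/-- The constraints given by the edges of a signed graph, along an enumeration of the edges. -/
noncomputable def toSignedEdges (S : SignedGraph V) {ι : Type*} (e : ι ≃ S.graph.edgeSet) :
    SignedEdges V ι where
  src i := (Quot.out (e i : Sym2 V)).1
  tgt i := (Quot.out (e i : Sym2 V)).2
  sgn i := S.sign (e i)

variable (S : SignedGraph V) {ι : Type*} (e : ι ≃ S.graph.edgeSet)

theorem mk_src_tgt (i : ι) :
    s((S.toSignedEdges e).src i, (S.toSignedEdges e).tgt i) = (e i : Sym2 V) :=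
  Quot.out_eq (e i : Sym2 V)

theorem adj_src_tgt (i : ι) :
    S.graph.Adj ((S.toSignedEdges e).src i) ((S.toSignedEdges e).tgt i) := by
  rw [← SimpleGraph.mem_edgeSet, mk_src_tgt]
  exact (e i).2

theorem toSignedEdges_simple : (S.toSignedEdges e).Simple :=
  ⟨fun i => (S.adj_src_tgt e i).ne, fun i j h => by
    rw [mk_src_tgt, mk_src_tgt] at h
    exact e.injective (Subtype.ext h)⟩

/-- Every pair of adjacent vertices is, up to order, the pair of endpoints of an enumerated edge. -/
theorem exists_index {u v : V} (h : S.graph.Adj u v) :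
    ∃ i, ((S.toSignedEdges e).sgn i : ℤ) = S.adjSign h ∧
      (((S.toSignedEdges e).src i = u ∧ (S.toSignedEdges e).tgt i = v) ∨
        ((S.toSignedEdges e).src i = v ∧ (S.toSignedEdges e).tgt i = u)) := by
  refine ⟨e.symm ⟨s(u, v), h⟩, ?_, ?_⟩
  · simp [toSignedEdges, adjSign]
  · have := S.mk_src_tgt e (e.symm ⟨s(u, v), h⟩)
    rw [Equiv.apply_symm_apply] at this
    exact Sym2.eq_iff.1 this

theorem isProper_iff (c : V → ℤ) : S.IsProper c ↔ ∀ i, ¬ (S.toSignedEdges e).Sat c i := by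
  constructor
  · intro h i hi
    refine h _ _ (S.adj_src_tgt e i) ?_
    rw [S.adjSign_eq_of_eq _ (S.mk_src_tgt e i)]
    exact hi
  · intro h u v huv hc
    obtain ⟨i, hi, ⟨rfl, rfl⟩ | ⟨rfl, rfl⟩⟩ := S.exists_index e huv
    · refine h i ?_
      unfold SignedEdges.Sat
      rw [hi, hc]
    · refine h i ?_
      unfold SignedEdges.Sat
      rw [hi]
      rcases S.adjSign_eq_or huv with h1 | h1 <;> rw [h1] at hc ⊢ <;> omega

theorem numListColorings_eq_properCount [Fintype V] [DecidableEq V] [Fintype ι]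
    (L : V → Finset ℤ) : S.numListColorings L = (S.toSignedEdges e).properCount L := by
  unfold numListColorings SignedEdges.properCount
  rw [← Set.ncard_coe_finset]
  congr 1
  ext c
  simp [S.isProper_iff e, and_comm]

theorem image_mul_eq_of_forall_mem {A B : Finset ℤ} (hAB : A.card = B.card) {σ : ℤ} (hσ : σ ≠ 0)
    (h : ∀ a ∈ A, σ * a ∈ B) : A.image (fun a => σ * a) = B := by
  refine Finset.eq_of_subset_of_card_le (Finset.image_subset_iff.2 h) ?_
  rw [Finset.card_image_of_injective _ fun a b hab => mul_left_cancel₀ hσ hab, hAB]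

/-- Zero defect means that the sign maps one list into the other, hence onto it by cardinality. The
arbitrary orientation of the edge is harmless because a sign is its own inverse. -/
theorem listsAgree_of_defect_eq_zero [Fintype V] {k : ℕ} {L : V → Finset ℤ}
    (hL : IsAssignment k L) (h : ∀ i, (S.toSignedEdges e).defect k L i = 0) :
    S.ListsAgree L := by
  have key : ∀ i, (L ((S.toSignedEdges e).src i)).image
      (fun a => ((S.toSignedEdges e).sgn i : ℤ) * a) = L ((S.toSignedEdges e).tgt i) := by
    intro i
    refine image_mul_eq_of_forall_mem ((hL _).trans (hL _).symm) (Units.ne_zero _) fun a ha => ?_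
    have hcard : (L ((S.toSignedEdges e).src i)).card ≤ ((S.toSignedEdges e).matched L i).card := by
      have h1 := h i
      have h2 := hL ((S.toSignedEdges e).src i)
      unfold SignedEdges.defect at h1
      omega
    rw [← Finset.eq_of_subset_of_card_le (Finset.filter_subset _ _) hcard] at ha
    exact (Finset.mem_filter.1 ha).2
  intro u v huv
  obtain ⟨i, hi, ⟨rfl, rfl⟩ | ⟨rfl, rfl⟩⟩ := S.exists_index e huv
  · rw [← hi, key]
  · rw [← key i, hi, Finset.image_image]
    have : (fun a => S.adjSign huv * a) ∘ (fun a => S.adjSign huv * a) = id := by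
      funext a
      rcases S.adjSign_eq_or huv with h1 | h1 <;> simp [h1]
    rw [this, Finset.image_id]

variable {S}

theorem ListsAgree.mem_iff {L : V → Finset ℤ} (h : S.ListsAgree L) {u v : V}
    (huv : S.graph.Adj u v) (a : ℤ) : a ∈ L u ↔ S.adjSign huv * a ∈ L v := by
  rw [h u v huv, Finset.mem_image]
  constructor
  · exact fun ha => ⟨a, ha, rfl⟩
  · rintro ⟨b, hb, hab⟩
    have h0 : S.adjSign huv ≠ 0 := Units.ne_zero _
    rwa [← mul_left_cancel₀ h0 hab]

theorem numNeg_cons {u v w : V} (h : S.graph.Adj u v) (p : S.graph.Walk v w) :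
    (-1 : ℤ) ^ S.numNeg (SimpleGraph.Walk.cons h p) = (-1) ^ S.numNeg p * S.adjSign h := by
  unfold numNeg
  rw [SimpleGraph.Walk.edges_cons, List.countP_cons]
  rcases Int.units_eq_one_or (S.sign ⟨s(u, v), h⟩) with h1 | h1
  · have hn : ¬ S.IsNegEdge s(u, v) := by
      rintro ⟨h', h2⟩
      rw [h1] at h2
      exact absurd h2 (by decide)
    simp [hn, adjSign, h1]
  · have hn : S.IsNegEdge s(u, v) := ⟨h, h1⟩
    simp [hn, adjSign, h1, pow_succ]

theorem ListsAgree.mem_iff_of_walk {L : V → Finset ℤ} (h : S.ListsAgree L) {u v : V}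
    (p : S.graph.Walk u v) (a : ℤ) : a ∈ L u ↔ (-1) ^ S.numNeg p * a ∈ L v := by
  induction p generalizing a with
  | nil => simp [numNeg]
  | cons huv p ih => rw [h.mem_iff huv, ih, numNeg_cons, mul_assoc]

/-- Carrying a color from `v` to the unbalanced cycle, once around it and back changes its sign. -/
theorem ListsAgree.listsSymmetric {L : V → Finset ℤ} (h : S.ListsAgree L) :
    S.ListsSymmetric L := by
  rintro C ⟨u, hu, w, -, hw⟩ v hv
  obtain ⟨p⟩ : S.graph.Reachable v u := SimpleGraph.ConnectedComponent.exact
    ((SimpleGraph.ConnectedComponent.mem_supp_iff _ _).1 hv |>.trans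
      ((SimpleGraph.ConnectedComponent.mem_supp_iff _ _).1 hu).symm)
  have key : ∀ a, a ∈ L v ↔ -a ∈ L v := fun a => by
    rw [h.mem_iff_of_walk p a, h.mem_iff_of_walk p (-a), h.mem_iff_of_walk w, hw.neg_one_pow]
    simp
  ext a
  rw [key a, Finset.mem_image]
  constructor
  · exact fun ha => ⟨-a, ha, neg_neg a⟩
  · rintro ⟨b, hb, rfl⟩
    simpa using hb

theorem card_colorSet (k : ℕ) : (colorSet k).card = k := by
  unfold colorSet
  split_ifs with h
  · rw [Finset.card_erase_of_mem (by rw [Finset.mem_Icc]; omega), Int.card_Icc]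
    have := Nat.two_mul_div_two_of_even h
    omega
  · rw [Int.card_Icc]
    have := Nat.two_mul_div_two_add_one_of_odd (Nat.not_even_iff_odd.1 h)
    omega

theorem neg_mem_colorSet (k : ℕ) : ∀ a ∈ colorSet k, -a ∈ colorSet k := by
  intro a
  unfold colorSet
  split_ifs <;> simp only [Finset.mem_erase, Finset.mem_Icc] <;> omega

theorem zero_mem_colorSet_iff (k : ℕ) : 0 ∈ colorSet k ↔ Odd k := by
  unfold colorSet
  split_ifs with h
  · simpa using h
  · rw [Finset.mem_Icc]
    exact iff_of_true (by omega) (Nat.not_even_iff_odd.1 h)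

/-- Main comparison, for assignments containing `0` exactly as the standard colour set does. -/
theorem numColorings_le_and_eq [Finite V] (S : SignedGraph V) {k : ℕ} (hk : 0 < k)
    (hkm : ((S.numEdges : ℝ) - 1) / Real.log (1 + Real.sqrt 2) < (k : ℝ)) {L : V → Finset ℤ}
    (hL : IsAssignment k L) (h0 : ∀ v, 0 ∈ L v ↔ Odd k) :
    S.numColorings k ≤ S.numListColorings L ∧
      (S.numListColorings L = S.numColorings k → S.ListsAgree L ∧ S.ListsSymmetric L) := by
  classical
  have := Fintype.ofFinite V
  have e : Fin S.numEdges ≃ S.graph.edgeSet := (Finite.equivFin S.graph.edgeSet).symm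
  have hnum : S.numColorings k = S.numListColorings fun _ => colorSet k := rfl
  have key := SignedEdges.properCount_le_and_eq (S.toSignedEdges_simple e) hk hL
    (neg_mem_colorSet k) (card_colorSet k)
    (fun v => (h0 v).trans (zero_mem_colorSet_iff k).symm) (by rwa [Fintype.card_fin])
  rw [hnum, S.numListColorings_eq_properCount e, S.numListColorings_eq_properCount e]
  refine ⟨key.1, fun heq => ?_⟩
  have := S.listsAgree_of_defect_eq_zero e hL (key.2 heq)
  exact ⟨this, this.listsSymmetric⟩

end SignedGraph

theorem theorem1p2 {V : Type*} [Finite V] (S : SignedGraph V) (k : ℕ) (hk : 0 < k)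
    (hkm : ((S.numEdges : ℝ) - 1) / Real.log (1 + Real.sqrt 2) < (k : ℝ)) :
    (Even k →
      IsLeast {N : ℕ | ∃ L : V → Finset ℤ, SignedGraph.IsAssignment k L ∧
          SignedGraph.ZeroFree L ∧ S.numListColorings L = N} (S.numColorings k) ∧
      ∀ L : V → Finset ℤ, SignedGraph.IsAssignment k L → SignedGraph.ZeroFree L →
        S.numListColorings L = S.numColorings k → S.ListsAgree L ∧ S.ListsSymmetric L) ∧
    (Odd k →
      IsLeast {N : ℕ | ∃ L : V → Finset ℤ, SignedGraph.IsAssignment k L ∧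
          SignedGraph.ZeroIncluded L ∧ S.numListColorings L = N} (S.numColorings k) ∧
      ∀ L : V → Finset ℤ, SignedGraph.IsAssignment k L → SignedGraph.ZeroIncluded L →
        S.numListColorings L = S.numColorings k → S.ListsAgree L ∧ S.ListsSymmetric L) := by
  have hcard : SignedGraph.IsAssignment k fun _ : V => SignedGraph.colorSet k :=
    fun _ => SignedGraph.card_colorSet k
  refine ⟨fun hke => ?_, fun hko => ?_⟩
  · have hz : ∀ L : V → Finset ℤ, SignedGraph.ZeroFree L → ∀ v, 0 ∈ L v ↔ Odd k := fun L hL v =>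
      iff_of_false (hL v) (Nat.not_odd_iff_even.2 hke)
    refine ⟨⟨⟨_, hcard, fun _ => ?_, rfl⟩, ?_⟩, fun L hL hL0 =>
      (S.numColorings_le_and_eq hk hkm hL (hz L hL0)).2⟩
    · rw [SignedGraph.zero_mem_colorSet_iff]
      exact Nat.not_odd_iff_even.2 hke
    · rintro N ⟨L, hL, hL0, rfl⟩
      exact (S.numColorings_le_and_eq hk hkm hL (hz L hL0)).1
  · have hz : ∀ L : V → Finset ℤ, SignedGraph.ZeroIncluded L → ∀ v, 0 ∈ L v ↔ Odd k :=
      fun L hL v => iff_of_true (hL v) hko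
    refine ⟨⟨⟨_, hcard, fun _ => ?_, rfl⟩, ?_⟩, fun L hL hL0 =>
      (S.numColorings_le_and_eq hk hkm hL (hz L hL0)).2⟩
    · rwa [SignedGraph.zero_mem_colorSet_iff]
    · rintro N ⟨L, hL, hL0, rfl⟩
      exact (S.numColorings_le_and_eq hk hkm hL (hz L hL0)).1
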